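/- **Setting.** A contextual bandit with finite context set $\mathcal X$, arm set $\mathcal A$ with $|\mathcal A|=A$, context distribution $\rho$ with full support on $\mathcal X$ and mean reward function $f:\mathcal X\times\mathcal A\to\mathbb R$: in every round $t$ a context $x_t\sim\rho$ is drawn independently of the past, the learner picks an arm $a_t$ (measurably, possibly with randomization, from the past contexts, arms and rewards and from $x_t$), and observes a reward distributed as $\mathcal N(f(x_t,a_t),1)$. The regret is $R_T(f)=\sum_{t=1}^T\big(\max_{a}f(x_t,a)-f(x_t,a_t)\big)$, and $\mathbb E_f^{\mathfrak A}$ is expectation under the algorithm $\mathfrak A$. A $d$-dimensional representation is a map $\phi:\mathcal X\times\mathcal A\to\mathbb R^d$, and for a set $\Phi$ of such maps $\mathcal F_\Phi=\{(x,a)\mapsto\phi(x,a)^{\mathsf T}\theta:\ \phi\in\Phi,\ \theta\in\mathbb R^d\}$. **Theorem.** There is a universal constant $c>0$ such that the following holds. Let $N\ge1$, $A\ge4$ and $d\ge12\log_2 A$ be integers, and put $$K=d\log_2A+A\left\lfloor\frac{\log(dN)}{\log A}\right\rfloor .$$ There exist a finite context set, a full-support context distribution, and a set $\Phi$ of $d$-dimensional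 representations over $A$ arms with $|\Phi|=N$ such that, for every learning algorithm $\mathfrak A$ and every integer $T\ge\max\{\lfloor\log(dN)/\log A\rfloor,\ d/\log_2A\}$, $$\sup_{f\in\mathcal F_\Phi}\mathbb E_f^{\mathfrak A}[R_T(f)]\ \ge\ c\sqrt{TK}.$$ Moreover, there is an $f\in\mathcal F_\Phi$ (depending on $\mathfrak A$ and $T$) with a unique optimal arm in every context and with rewards $0\le f(x,a)\le\sqrt{K/T}$ for all $x,a$ such that $\mathbb E_f^{\mathfrak A}[R_T(f)]\ge c\sqrt{TK}$. -/

import Mathlib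

open MeasureTheory ProbabilityTheory

namespace ContextualBandit

variable {X A : Type*} [MeasurableSpace X] [MeasurableSpace A]

/-- Histories of length `t`: the sequence of (context, arm, reward) triples of the first `t`
rounds. -/
abbrev History (X A : Type*) (t : ℕ) : Type _ := Fin t → X × A × ℝ

/-- A (possibly randomized) learning algorithm: in every round it maps the history so far and
the current context measurably to a distribution over arms. Deterministic strategies, i.e.
sequences of measurable maps `(X × A × ℝ)ᵗ × X → A`, are the case of Dirac-valued kernels. -/
structure Algorithm (X A : Type*) [MeasurableSpace X] [MeasurableSpace A] where
  /-- The decision rule used after `t` complete rounds. -/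
  policy : (t : ℕ) → Kernel (History X A t × X) A
  markov : ∀ t, IsMarkovKernel (policy t)

section Model

variable [Countable X] [Countable A] [MeasurableSingletonClass X] [MeasurableSingletonClass A]

/-- Given a context and an arm, the reward is Gaussian with mean `f x a` and unit variance. -/
noncomputable def rewardKernel (f : X → A → ℝ) : Kernel (X × A) ℝ :=
  Kernel.ofFunOfCountable fun p => gaussianReal (f p.1 p.2) 1

/-- The conditional law of round `t` (counted from `0`) given the history: the context is drawn
from `ρ` independently of the past, then the arm by the algorithm, then the reward. -/
noncomputable def roundKernel (ρ : Measure X) (f : X → A → ℝ) (alg : Algorithm X A) (t : ℕ) :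
    Kernel (History X A t) (X × A × ℝ) :=
  Kernel.const (History X A t) ρ ⊗ₖ
    (alg.policy t ⊗ₖ
      (rewardKernel f).comap (fun z : (History X A t × X) × A => (z.1.2, z.2))
        (by fun_prop))

/-- The law of the history of the first `t` rounds when `alg` interacts with the contextual
bandit with context distribution `ρ` and mean reward function `f`. -/
noncomputable def historyLaw (ρ : Measure X) (f : X → A → ℝ) (alg : Algorithm X A) :
    (t : ℕ) → Measure (History X A t)
  | 0 => Measure.dirac (fun i => i.elim0)
  | t + 1 => ((historyLaw ρ f alg t) ⊗ₘ (roundKernel ρ f alg t)).map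
      (fun p => (Fin.snoc p.1 p.2 : History X A (t + 1)))

/-- Cumulative regret along a history. -/
noncomputable def regret (f : X → A → ℝ) {T : ℕ} (h : History X A T) : ℝ :=
  ∑ t, ((⨆ a, f (h t).1 a) - f (h t).1 (h t).2.1)

/-- Expected cumulative regret of `alg` after `T` rounds. -/
noncomputable def expectedRegret (ρ : Measure X) (f : X → A → ℝ) (alg : Algorithm X A)
    (T : ℕ) : ℝ :=
  ∫ h, regret f h ∂(historyLaw ρ f alg T)

end Model

/-- The class of reward functions that are linear in some representation
`φ : X → A → ℝᵈ` of the set `Φ`. -/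
def functionClass {X A : Type*} {d : ℕ} (Φ : Set (X → A → Fin d → ℝ)) : Set (X → A → ℝ) :=
  {f | ∃ φ ∈ Φ, ∃ θ : Fin d → ℝ, ∀ x a, f x a = φ x a ⬝ᵥ θ}

end ContextualBandit

set_option linter.unusedSectionVars false

namespace ContextualBandit

/-! ### Law of the interaction and change of measure between reward functions. -/

section Interaction

variable {X A : Type*} [MeasurableSpace X] [MeasurableSpace A]
  [Fintype X] [Fintype A] [MeasurableSingletonClass X] [MeasurableSingletonClass A]

/-! Take `n` equally likely contexts and give each arm a word of length `m` over `B` symbols, every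
word being spelt by exactly one arm. A hidden word per context is encoded by `θ`, and an arm earns
`Δ` for each symbol it matches (`matchReward`).

To bound the matches, resample a single symbol `b` of `θ` and compare with the instance in which
that coordinate earns nothing. The comparison instance does not know `b`. The divergence from it is
`Δ ^ 2 / (2 * n)` times the expected number of rounds whose policy would show `b` there, and summed
over `b` these numbers are at most `T`. For `Δ ^ 2 = n * B / (32 * T)` an average symbol is
therefore matched with probability at most `3 / 4` (`sum_symbolProb_update_le`), so some `θ` has
regret at least `T * m * Δ / 4`, which is of order `√(T * n * B * m ^ 2)`
(`exists_le_expectedRegret_matchReward`).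

It remains to realise the larger summand of `K` as `n * B * m ^ 2`, up to constants. For `d * log₂
A`, use binary words with `m ≈ log₂ A` and `n ≈ d / (2 * m)`; all rewards are linear in one
representation. For `A * L`, with `L` the floor in `K`, use one-letter words over `A` symbols and `n
= L`; the `A ^ L ≤ d * N` rewards are distributed as coordinates over `N` representations. -/

instance (alg : Algorithm X A) (t : ℕ) : IsMarkovKernel (alg.policy t) := alg.markov t

instance (f : X → A → ℝ) : IsMarkovKernel (rewardKernel f) :=
  ⟨fun p => inferInstanceAs (IsProbabilityMeasure (gaussianReal (f p.1 p.2) 1))⟩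

instance (ρ : Measure X) [IsProbabilityMeasure ρ] (f : X → A → ℝ) (alg : Algorithm X A) (t : ℕ) :
    IsMarkovKernel (roundKernel ρ f alg t) := by
  unfold roundKernel; infer_instance

lemma measurable_snoc (t : ℕ) :
    Measurable (fun p : History X A t × (X × A × ℝ) =>
      (Fin.snoc p.1 p.2 : History X A (t + 1))) := by
  refine measurable_pi_lambda _ fun i => ?_
  refine Fin.lastCases ?_ (fun i => ?_) i
  · simpa using measurable_snd
  · simp only [Fin.snoc_castSucc]
    exact (measurable_pi_apply i).comp measurable_fst

instance (ρ : Measure X) [IsProbabilityMeasure ρ] (f : X → A → ℝ) (alg : Algorithm X A) (t : ℕ) :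
    IsProbabilityMeasure (historyLaw ρ f alg t) := by
  induction t with
  | zero => unfold historyLaw; infer_instance
  | succ t ih =>
    unfold historyLaw
    exact Measure.isProbabilityMeasure_map (measurable_snoc t).aemeasurable

lemma measurable_of_forall_reward {γ : Type*} [MeasurableSpace γ] {ψ : X × A × ℝ → γ}
    (h : ∀ x a, Measurable fun r => ψ (x, a, r)) : Measurable ψ :=
  measurable_from_prod_countable_right fun x => measurable_from_prod_countable_right fun a => h x a

variable (ρ : Measure X) [IsProbabilityMeasure ρ] (f g : X → A → ℝ) (alg : Algorithm X A)

lemma lintegral_roundKernel (t : ℕ) (h : History X A t) {G : X × A × ℝ → ENNReal}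
    (hG : Measurable G) :
    ∫⁻ p, G p ∂(roundKernel ρ f alg t h) =
      ∫⁻ x, ∫⁻ a, ∫⁻ r, G (x, a, r) ∂(gaussianReal (f x a) 1) ∂(alg.policy t (h, x)) ∂ρ := by
  unfold roundKernel
  rw [Kernel.lintegral_compProd _ _ _ hG]
  refine lintegral_congr fun x => ?_
  have hx : Measurable fun q : A × ℝ => G (x, q) := hG.comp measurable_prodMk_left
  rw [Kernel.lintegral_compProd _ _ _ hx]
  rfl

lemma integrable_roundKernel (t : ℕ) (h : History X A t) {ψ : X × A × ℝ → ℝ} (hm : Measurable ψ)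
    (hψ : ∀ x a, Integrable (fun r => ψ (x, a, r)) (gaussianReal (f x a) 1)) :
    Integrable ψ (roundKernel ρ f alg t h) := by
  unfold roundKernel
  rw [integrable_compProd_iff hm.aestronglyMeasurable]
  refine ⟨Filter.Eventually.of_forall fun x => ?_, .of_finite⟩
  have hx : Measurable fun q : A × ℝ => ψ (x, q) := hm.comp measurable_prodMk_left
  rw [integrable_compProd_iff hx.aestronglyMeasurable]
  exact ⟨Filter.Eventually.of_forall fun a => hψ x a, .of_finite⟩

lemma integral_roundKernel (t : ℕ) (h : History X A t) {ψ : X × A × ℝ → ℝ} (hm : Measurable ψ)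
    (hψ : ∀ x a, Integrable (fun r => ψ (x, a, r)) (gaussianReal (f x a) 1)) :
    ∫ p, ψ p ∂(roundKernel ρ f alg t h) =
      ∑ x, ρ.real {x} * ∑ a, (alg.policy t (h, x)).real {a} *
        ∫ r, ψ (x, a, r) ∂(gaussianReal (f x a) 1) := by
  have hi := integrable_roundKernel ρ f alg t h hm hψ
  unfold roundKernel at hi ⊢
  have hi' := (integrable_compProd_iff hm.aestronglyMeasurable).1 hi
  rw [integral_compProd hi, integral_fintype .of_finite]
  refine Finset.sum_congr rfl fun x _ => ?_
  rw [smul_eq_mul, integral_compProd, integral_fintype .of_finite]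
  · rfl
  have hx : Measurable fun q : A × ℝ => ψ (x, q) := hm.comp measurable_prodMk_left
  rw [integrable_compProd_iff hx.aestronglyMeasurable]
  exact ⟨Filter.Eventually.of_forall fun a => hψ x a, .of_finite⟩

/-- The probability that `alg` plays `a` in round `t` if the context of that round is `x`. -/
noncomputable def armProb (t : ℕ) (x : X) (a : A) : ℝ :=
  ∫ h, (alg.policy t (h, x)).real {a} ∂(historyLaw ρ f alg t)

lemma measurable_policy (t : ℕ) (x : X) (a : A) :
    Measurable fun h : History X A t => (alg.policy t (h, x)).real {a} :=
  ((alg.policy t).measurable_coe (measurableSet_singleton a)).ennreal_toReal.comp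
    measurable_prodMk_right

lemma integrable_policy (μ : Measure (History X A t)) [IsFiniteMeasure μ] (x : X) (a : A) :
    Integrable (fun h : History X A t => (alg.policy t (h, x)).real {a}) μ :=
  Integrable.of_bound (measurable_policy alg t x a).aestronglyMeasurable 1
    (Filter.Eventually.of_forall fun h => by
      rw [Real.norm_of_nonneg measureReal_nonneg]; exact measureReal_le_one)

lemma armProb_nonneg (t : ℕ) (x : X) (a : A) : 0 ≤ armProb ρ f alg t x a :=
  integral_nonneg fun _ => measureReal_nonneg

lemma sum_policy (t : ℕ) (p : History X A t × X) : ∑ a, (alg.policy t p).real {a} = 1 := by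
  simp

lemma sum_armProb (t : ℕ) (x : X) : ∑ a, armProb ρ f alg t x a = 1 := by
  unfold armProb
  rw [← integral_finsetSum _ fun a _ => integrable_policy alg _ x a]
  simp only [sum_policy, integral_const, probReal_univ, smul_eq_mul, mul_one]

/-- Expectation of an additive functional of the history. -/
lemma integrable_integral_sum_historyLaw {ψ : X × A × ℝ → ℝ} (hm : Measurable ψ)
    (hψ : ∀ x a, Integrable (fun r => ψ (x, a, r)) (gaussianReal (f x a) 1)) (t : ℕ) :
    Integrable (fun h => ∑ s, ψ (h s)) (historyLaw ρ f alg t) ∧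
    ∫ h, ∑ s, ψ (h s) ∂(historyLaw ρ f alg t) =
      ∑ s ∈ Finset.range t, ∑ x, ρ.real {x} * ∑ a, armProb ρ f alg s x a *
        ∫ r, ψ (x, a, r) ∂(gaussianReal (f x a) 1) := by
  induction t with
  | zero => simp
  | succ t ih =>
    have hmeas : Measurable fun h : History X A (t + 1) => ∑ s, ψ (h s) :=
      Finset.measurable_sum _ fun s _ => hm.comp (measurable_pi_apply s)
    set M := historyLaw ρ f alg t ⊗ₘ roundKernel ρ f alg t with hM
    have hL : historyLaw ρ f alg (t + 1) =
        M.map fun p => (Fin.snoc p.1 p.2 : History X A (t + 1)) := rfl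
    have h1 : Integrable (fun p => ∑ s, ψ (p.1 s)) M := by
      have : MeasurePreserving Prod.fst M (historyLaw ρ f alg t) :=
        ⟨measurable_fst, Measure.fst_compProd _ _⟩
      exact this.integrable_comp_of_integrable ih.1
    have h1' : ∫ p, ∑ s, ψ (p.1 s) ∂M = ∫ h, ∑ s, ψ (h s) ∂(historyLaw ρ f alg t) := by
      rw [hM, Measure.integral_compProd h1]; simp
    have hsum : ∀ φ : X → A → ℝ, Integrable (fun h : History X A t => ∑ x, ρ.real {x} *
        ∑ a, (alg.policy t (h, x)).real {a} * φ x a) (historyLaw ρ f alg t) := fun φ =>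
      integrable_finsetSum _ fun x _ => (integrable_finsetSum _ fun a _ =>
        (integrable_policy alg _ x a).mul_const _).const_mul _
    have h2 : Integrable (fun p => ψ p.2) M := by
      have hm' : Measurable fun p : History X A t × (X × A × ℝ) => ψ p.2 := hm.comp measurable_snd
      rw [hM, Measure.integrable_compProd_iff hm'.aestronglyMeasurable]
      refine ⟨Filter.Eventually.of_forall fun h => integrable_roundKernel ρ f alg t h hm hψ, ?_⟩
      simp_rw [fun h => integral_roundKernel ρ f alg t h hm.norm fun x a => (hψ x a).norm]
      exact hsum fun x a => ∫ r, ‖ψ (x, a, r)‖ ∂(gaussianReal (f x a) 1)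
    -- The new context is independent of the history, so averaging over histories only turns the
    -- policy into `armProb`.
    have h2' : ∫ p, ψ p.2 ∂M = ∑ x, ρ.real {x} * ∑ a, armProb ρ f alg t x a *
        ∫ r, ψ (x, a, r) ∂(gaussianReal (f x a) 1) := by
      rw [hM, Measure.integral_compProd h2]
      simp_rw [fun h => integral_roundKernel ρ f alg t h hm hψ]
      rw [integral_finsetSum _ fun x _ => (integrable_finsetSum _ fun a _ =>
        (integrable_policy alg _ x a).mul_const _).const_mul _]
      refine Finset.sum_congr rfl fun x _ => ?_
      rw [integral_const_mul, integral_finsetSum _ fun a _ =>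
        (integrable_policy alg _ x a).mul_const _]
      simp_rw [integral_mul_const]
      rfl
    have hsnoc : ∀ p : History X A t × (X × A × ℝ),
        ∑ s, ψ ((Fin.snoc p.1 p.2 : History X A (t + 1)) s) = (∑ s, ψ (p.1 s)) + ψ p.2 := by
      intro p
      rw [Fin.sum_univ_castSucc]
      simp
    rw [hL, integrable_map_measure hmeas.aestronglyMeasurable (measurable_snoc t).aemeasurable,
      integral_map (measurable_snoc t).aemeasurable hmeas.aestronglyMeasurable]
    simp only [Function.comp_def, hsnoc]
    refine ⟨h1.add h2, ?_⟩
    rw [integral_add h1 h2, h1', h2', ih.2, Finset.sum_range_succ]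

/-- Expected regret in terms of the probabilities of playing each arm. -/
lemma expectedRegret_eq (T : ℕ) :
    expectedRegret ρ f alg T = ∑ t ∈ Finset.range T, ∑ x, ρ.real {x} *
      ∑ a, armProb ρ f alg t x a * ((⨆ b, f x b) - f x a) := by
  have := (integrable_integral_sum_historyLaw ρ f alg
    (ψ := fun p => (⨆ b, f p.1 b) - f p.1 p.2.1)
    (measurable_of_forall_reward fun x a => by fun_prop) (fun x a => by simp) T).2
  refine Eq.trans this ?_
  simp only [integral_const, probReal_univ, one_smul]

/-- Log-likelihood ratio of one round between the mean reward functions `f` and `g`. -/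
noncomputable def logRatio (p : X × A × ℝ) : ℝ :=
  (f p.1 p.2.1 - g p.1 p.2.1) * (p.2.2 - g p.1 p.2.1) - (f p.1 p.2.1 - g p.1 p.2.1) ^ 2 / 2

lemma measurable_logRatio : Measurable (logRatio f g) := by
  refine measurable_of_forall_reward fun x a => ?_
  unfold logRatio
  fun_prop

lemma lintegral_gaussianReal_shift (m m' : ℝ) {G : ℝ → ENNReal} (hG : Measurable G) :
    ∫⁻ r, G r ∂(gaussianReal m' 1) =
      ∫⁻ r, ENNReal.ofReal (Real.exp ((m' - m) * (r - m) - (m' - m) ^ 2 / 2)) * G r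
        ∂(gaussianReal m 1) := by
  rw [gaussianReal_of_var_ne_zero _ one_ne_zero, gaussianReal_of_var_ne_zero _ one_ne_zero,
    lintegral_withDensity_eq_lintegral_mul _ (measurable_gaussianPDF _ _) hG,
    lintegral_withDensity_eq_lintegral_mul _ (measurable_gaussianPDF _ _) (by fun_prop)]
  refine lintegral_congr fun r => ?_
  simp only [Pi.mul_apply, ← mul_assoc]
  congr 1
  rw [gaussianPDF, gaussianPDF, ← ENNReal.ofReal_mul (gaussianPDFReal_nonneg _ _ _)]
  congr 1
  rw [gaussianPDFReal, gaussianPDFReal, mul_assoc _ (Real.exp _) (Real.exp _), ← Real.exp_add]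
  congr 2
  push_cast
  ring

/-- Contexts and arms are drawn by the same kernels under `f` and `g`, so only the Gaussian density
ratio of the reward remains. -/
lemma lintegral_roundKernel_change (t : ℕ) (h : History X A t) {G : X × A × ℝ → ENNReal}
    (hG : Measurable G) :
    ∫⁻ p, G p ∂(roundKernel ρ f alg t h) =
      ∫⁻ p, ENNReal.ofReal (Real.exp (logRatio f g p)) * G p ∂(roundKernel ρ g alg t h) := by
  have := measurable_logRatio f g
  rw [lintegral_roundKernel _ _ _ _ _ hG, lintegral_roundKernel _ _ _ _ _ (by fun_prop)]
  refine lintegral_congr fun x => lintegral_congr fun a => ?_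
  exact lintegral_gaussianReal_shift _ _ (hG.comp (by fun_prop))

lemma lintegral_historyLaw_succ (t : ℕ) {F : History X A (t + 1) → ENNReal} (hF : Measurable F) :
    ∫⁻ h, F h ∂(historyLaw ρ f alg (t + 1)) =
      ∫⁻ h, ∫⁻ p, F (Fin.snoc h p) ∂(roundKernel ρ f alg t h) ∂(historyLaw ρ f alg t) := by
  have hF' : Measurable fun p : History X A t × (X × A × ℝ) => F (Fin.snoc p.1 p.2) :=
    hF.comp (measurable_snoc t)
  rw [historyLaw, lintegral_map hF (measurable_snoc t), Measure.lintegral_compProd hF']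

/-- Change of measure between two mean reward functions. -/
lemma lintegral_historyLaw_change (t : ℕ) {F : History X A t → ENNReal} (hF : Measurable F) :
    ∫⁻ h, F h ∂(historyLaw ρ f alg t) =
      ∫⁻ h, ENNReal.ofReal (Real.exp (∑ s, logRatio f g (h s))) * F h
        ∂(historyLaw ρ g alg t) := by
  induction t with
  | zero => simp [historyLaw]
  | succ t ih =>
    have hl := measurable_logRatio f g
    have hF' : Measurable fun p : History X A t × (X × A × ℝ) => F (Fin.snoc p.1 p.2) :=
      hF.comp (measurable_snoc t)
    have hF'' : ∀ h : History X A t, Measurable fun p : X × A × ℝ =>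
        ENNReal.ofReal (Real.exp (logRatio f g p)) * F (Fin.snoc h p) := fun h =>
      Measurable.mul (by fun_prop) (hF'.comp measurable_prodMk_left)
    have hs := measurable_snoc (X := X) (A := A) t
    rw [lintegral_historyLaw_succ _ _ _ _ hF, lintegral_historyLaw_succ _ _ _ _ (by fun_prop)]
    simp_rw [fun h => lintegral_roundKernel_change ρ f g alg t h
      (G := fun p => F (Fin.snoc h p)) (hF'.comp measurable_prodMk_left)]
    rw [ih]
    · refine lintegral_congr fun h => ?_
      rw [← lintegral_const_mul _ (hF'' h)]
      refine lintegral_congr fun p => ?_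
      rw [Fin.sum_univ_castSucc, Real.exp_add, ENNReal.ofReal_mul (Real.exp_nonneg _)]
      simp [mul_assoc]
    · refine Measurable.lintegral_kernel_prod_right' (f := fun q : History X A t × (X × A × ℝ) =>
        ENNReal.ofReal (Real.exp (logRatio f g q.2)) * F (Fin.snoc q.1 q.2)) ?_
      exact Measurable.mul (by fun_prop) hF'

lemma historyLaw_eq_withDensity (t : ℕ) :
    historyLaw ρ f alg t = (historyLaw ρ g alg t).withDensity
      fun h => ENNReal.ofReal (Real.exp (∑ s, logRatio f g (h s))) := by
  have hl := measurable_logRatio f g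
  have hm : Measurable fun h : History X A t =>
      ENNReal.ofReal (Real.exp (∑ s, logRatio f g (h s))) := by fun_prop
  refine Measure.ext_of_lintegral _ fun F hF => ?_
  rw [lintegral_historyLaw_change ρ f g alg t hF,
    lintegral_withDensity_eq_lintegral_mul _ hm hF]
  rfl

/-- Expected log-likelihood ratio of the history. -/
lemma integrable_integral_logRatio (t : ℕ) :
    Integrable (fun h => ∑ s, logRatio f g (h s)) (historyLaw ρ g alg t) ∧
    ∫ h, ∑ s, logRatio f g (h s) ∂(historyLaw ρ g alg t) =
      -∑ s ∈ Finset.range t, ∑ x, ρ.real {x} * ∑ a, armProb ρ g alg s x a *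
        ((f x a - g x a) ^ 2 / 2) := by
  have hid : ∀ m : ℝ, Integrable (fun r : ℝ => r) (gaussianReal m 1) := fun m =>
    (memLp_id_gaussianReal (μ := m) (v := 1) 1).integrable (by simp)
  have hid' : ∀ m c : ℝ, Integrable (fun r : ℝ => r - c) (gaussianReal m 1) := fun m c =>
    (hid m).sub (integrable_const c)
  have hi : ∀ x a, Integrable (fun r => logRatio f g (x, a, r)) (gaussianReal (g x a) 1) :=
    fun x a => by
      have := ((hid' (g x a) (g x a)).const_mul (f x a - g x a)).sub
        (integrable_const ((f x a - g x a) ^ 2 / 2))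
      exact this
  have := integrable_integral_sum_historyLaw ρ g alg (measurable_logRatio f g) hi t
  refine ⟨this.1, this.2.trans ?_⟩
  simp only [← Finset.sum_neg_distrib, ← mul_neg]
  refine Finset.sum_congr rfl fun s _ => Finset.sum_congr rfl fun x _ => ?_
  congr 1
  refine Finset.sum_congr rfl fun a _ => ?_
  congr 1
  unfold logRatio
  simp only
  rw [integral_sub ((hid' _ _).const_mul _) (integrable_const _),
    integral_const_mul, integral_sub (hid _) (integrable_const _), integral_id_gaussianReal]
  simp

end Interaction

/-! ### Pinsker-type comparison of probabilities. -/

/-- A Pinsker-type inequality: the expectation of a `[0, 1]`-valued variable changes by at most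
`s / 2 * KL + 2 / s` when the measure is changed to one with log-density `L`. -/
lemma integral_withDensity_exp_le {Ω : Type*} [MeasurableSpace Ω] (P : Measure Ω)
    [IsProbabilityMeasure P] {L : Ω → ℝ} (hLm : Measurable L) (hL : Integrable L P)
    [hQ : IsProbabilityMeasure (P.withDensity fun ω => ENNReal.ofReal (Real.exp (L ω)))]
    {Z : Ω → ℝ} (hZ : Measurable Z) (h0 : ∀ ω, 0 ≤ Z ω) (h1 : ∀ ω, Z ω ≤ 1) {s : ℝ} (hs : 0 < s) :
    ∫ ω, Z ω ∂(P.withDensity fun ω => ENNReal.ofReal (Real.exp (L ω))) ≤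
      ∫ ω, Z ω ∂P + s / 2 * (-∫ ω, L ω ∂P) + 2 / s := by
  have hDm : Measurable fun ω => ENNReal.ofReal (Real.exp (L ω)) := by fun_prop
  have hmass : ∫⁻ ω, ENNReal.ofReal (Real.exp (L ω)) ∂P = 1 := by
    rw [← setLIntegral_univ, ← withDensity_apply _ MeasurableSet.univ, hQ.measure_univ]
  have hexp : Integrable (fun ω => Real.exp (L ω)) P := by
    refine ⟨by fun_prop, ?_⟩
    rw [hasFiniteIntegral_iff_ofReal (Filter.Eventually.of_forall fun ω => Real.exp_nonneg _),
      hmass]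
    simp
  have hexp1 : ∫ ω, Real.exp (L ω) ∂P = 1 := by
    rw [integral_eq_lintegral_of_nonneg_ae (Filter.Eventually.of_forall fun ω => Real.exp_nonneg _)
      (by fun_prop), hmass]
    simp
  have hsq : ∀ ω, Real.exp (L ω) = Real.exp (L ω / 2) ^ 2 := fun ω => by
    rw [← Real.exp_nat_mul]; congr 1; push_cast; ring
  have hhalf : Integrable (fun ω => Real.exp (L ω / 2)) P := by
    refine Integrable.mono' (hexp.add (integrable_const 1)) (by fun_prop)
      (Filter.Eventually.of_forall fun ω => ?_)
    rw [Real.norm_of_nonneg (Real.exp_nonneg _), Pi.add_apply, hsq]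
    nlinarith [sq_nonneg (Real.exp (L ω / 2) - 1), Real.exp_nonneg (L ω / 2)]
  -- This bounds the squared Hellinger distance `2 - 2 * ∫ exp (L / 2)` by the divergence `-∫ L`.
  have hhalf_lower : 1 + (∫ ω, L ω ∂P) / 2 ≤ ∫ ω, Real.exp (L ω / 2) ∂P := by
    have : ∫ ω, (1 + L ω / 2) ∂P = 1 + (∫ ω, L ω ∂P) / 2 := by
      rw [integral_add (integrable_const _) (hL.div_const _), integral_div]; simp
    rw [← this]
    exact integral_mono ((integrable_const _).add (hL.div_const _)) hhalf fun ω => by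
      have := Real.add_one_le_exp (L ω / 2); linarith
  have hhalf_upper : ∫ ω, Real.exp (L ω / 2) ∂P ≤ 1 := by
    have : ∫ ω, (1 + Real.exp (L ω)) / 2 ∂P = 1 := by
      rw [integral_div, integral_add (integrable_const _) hexp, hexp1]; simp
    rw [← this]
    refine integral_mono hhalf (((integrable_const _).add hexp).div_const _) fun ω => ?_
    simp only
    rw [hsq]
    nlinarith [sq_nonneg (Real.exp (L ω / 2) - 1)]
  have hZi : Integrable Z P := Integrable.of_bound hZ.aestronglyMeasurable 1
    (Filter.Eventually.of_forall fun ω => by rw [Real.norm_of_nonneg (h0 ω)]; exact h1 ω)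
  rw [integral_withDensity_eq_integral_toReal_smul hDm (by simp)]
  have hZe : Integrable (fun ω => Real.exp (L ω) * Z ω) P := by
    refine Integrable.mono' hexp (by fun_prop) (Filter.Eventually.of_forall fun ω => ?_)
    rw [Real.norm_of_nonneg (mul_nonneg (Real.exp_nonneg _) (h0 ω))]
    exact mul_le_of_le_one_right (Real.exp_nonneg _) (h1 ω)
  -- With `u = exp (L / 2)`, factor `exp L - 1 = (u - 1) * (u + 1)` and apply the weighted AM-GM
  -- inequality; the resulting bound is nonnegative, so the factor `Z ≤ 1` can be dropped from it.
  have hpt : ∀ ω, Real.exp (L ω) * Z ω ≤ Z ω +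
      (s / 2 * (Real.exp (L ω) + 1 - 2 * Real.exp (L ω / 2)) +
        1 / (2 * s) * (Real.exp (L ω) + 1 + 2 * Real.exp (L ω / 2))) := by
    intro ω
    rw [hsq]
    set u := Real.exp (L ω / 2)
    have hu : 0 ≤ u := Real.exp_nonneg _
    have key : u ^ 2 - 1 ≤ s / 2 * (u - 1) ^ 2 + 1 / (2 * s) * (u + 1) ^ 2 := by
      have : s / 2 * (u - 1) ^ 2 + 1 / (2 * s) * (u + 1) ^ 2 - (u ^ 2 - 1) =
          (s * (u - 1) - (u + 1)) ^ 2 / (2 * s) := by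
        field_simp; ring
      have h2 : 0 ≤ (s * (u - 1) - (u + 1)) ^ 2 / (2 * s) := by positivity
      linarith
    have hR : 0 ≤ s / 2 * (u - 1) ^ 2 + 1 / (2 * s) * (u + 1) ^ 2 := by positivity
    have : (u ^ 2 - 1) * Z ω ≤ s / 2 * (u - 1) ^ 2 + 1 / (2 * s) * (u + 1) ^ 2 := by
      nlinarith [h0 ω, h1 ω, mul_le_mul_of_nonneg_right key (h0 ω),
        mul_le_mul_of_nonneg_left (h1 ω) hR]
    nlinarith
  have hexp' : Integrable (fun ω => Real.exp (L ω) + 1) P := hexp.add (integrable_const _)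
  have hi1 : Integrable (fun ω => Real.exp (L ω) + 1 - 2 * Real.exp (L ω / 2)) P :=
    hexp'.sub (hhalf.const_mul _)
  have hi2 : Integrable (fun ω => Real.exp (L ω) + 1 + 2 * Real.exp (L ω / 2)) P :=
    hexp'.add (hhalf.const_mul _)
  have hi3 : Integrable (fun ω => s / 2 * (Real.exp (L ω) + 1 - 2 * Real.exp (L ω / 2)) +
      1 / (2 * s) * (Real.exp (L ω) + 1 + 2 * Real.exp (L ω / 2))) P :=
    (hi1.const_mul _).add (hi2.const_mul _)
  have e1 : ∫ ω, (Real.exp (L ω) + 1 - 2 * Real.exp (L ω / 2)) ∂P =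
      2 - 2 * ∫ ω, Real.exp (L ω / 2) ∂P := by
    rw [integral_sub hexp' (hhalf.const_mul _),
      integral_add hexp (integrable_const _), hexp1, integral_const_mul]
    simp; norm_num
  have e2 : ∫ ω, (Real.exp (L ω) + 1 + 2 * Real.exp (L ω / 2)) ∂P =
      2 + 2 * ∫ ω, Real.exp (L ω / 2) ∂P := by
    rw [integral_add hexp' (hhalf.const_mul _),
      integral_add hexp (integrable_const _), hexp1, integral_const_mul]
    simp; norm_num
  calc ∫ ω, (ENNReal.ofReal (Real.exp (L ω))).toReal • Z ω ∂P
      = ∫ ω, Real.exp (L ω) * Z ω ∂P := by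
        simp [ENNReal.toReal_ofReal (Real.exp_nonneg _)]
    _ ≤ ∫ ω, (Z ω + (s / 2 * (Real.exp (L ω) + 1 - 2 * Real.exp (L ω / 2)) +
        1 / (2 * s) * (Real.exp (L ω) + 1 + 2 * Real.exp (L ω / 2)))) ∂P :=
        integral_mono hZe (hZi.add hi3) hpt
    _ = ∫ ω, Z ω ∂P + (s / 2 * (2 - 2 * ∫ ω, Real.exp (L ω / 2) ∂P) +
        1 / (2 * s) * (2 + 2 * ∫ ω, Real.exp (L ω / 2) ∂P)) := by
        rw [integral_add hZi hi3,
          integral_add (hi1.const_mul _) (hi2.const_mul _), integral_const_mul,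
          integral_const_mul, e1, e2]
    _ ≤ _ := by
        rw [add_assoc]
        gcongr
        · linarith
        · calc 1 / (2 * s) * (2 + 2 * ∫ ω, Real.exp (L ω / 2) ∂P) ≤ 1 / (2 * s) * 4 := by
                gcongr; linarith
            _ = 2 / s := by field_simp; norm_num

section Comparison

variable {X A : Type*} [MeasurableSpace X] [MeasurableSpace A]
  [Fintype X] [Fintype A] [MeasurableSingletonClass X] [MeasurableSingletonClass A]

/-- The probability of playing an arm of `S` under `f` compared to that under `g`. -/
lemma sum_armProb_le (ρ : Measure X) [IsProbabilityMeasure ρ] (f g : X → A → ℝ)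
    (alg : Algorithm X A) (t : ℕ) (x : X) (S : Finset A) {s : ℝ} (hs : 0 < s) :
    ∑ a ∈ S, armProb ρ f alg t x a ≤ ∑ a ∈ S, armProb ρ g alg t x a +
      s / 2 * (∑ s ∈ Finset.range t, ∑ x, ρ.real {x} * ∑ a, armProb ρ g alg s x a *
        ((f x a - g x a) ^ 2 / 2)) + 2 / s := by
  have hl := measurable_logRatio f g
  have hLm : Measurable fun h : History X A t => ∑ s, logRatio f g (h s) := by fun_prop
  obtain ⟨hLi, hL⟩ := integrable_integral_logRatio ρ f g alg t
  have hW := historyLaw_eq_withDensity ρ f g alg t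
  have : IsProbabilityMeasure ((historyLaw ρ g alg t).withDensity
      fun h => ENNReal.ofReal (Real.exp (∑ s, logRatio f g (h s)))) := hW ▸ inferInstance
  have key := integral_withDensity_exp_le (historyLaw ρ g alg t) hLm hLi
    (Z := fun h => ∑ a ∈ S, (alg.policy t (h, x)).real {a})
    (Finset.measurable_sum _ fun a _ => measurable_policy alg t x a)
    (fun h => Finset.sum_nonneg fun a _ => measureReal_nonneg)
    (fun h => (Finset.sum_le_sum_of_subset_of_nonneg (Finset.subset_univ S)
      fun a _ _ => measureReal_nonneg).trans (sum_policy alg t (h, x)).le) hs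
  rw [← hW, hL, neg_neg, integral_finsetSum _ fun a _ => integrable_policy alg _ x a,
    integral_finsetSum _ fun a _ => integrable_policy alg _ x a] at key
  exact key

end Comparison

/-- Averaging over all `θ` may be preceded by resampling one coordinate. -/
lemma sum_sum_update {P β : Type*} [Fintype P] [DecidableEq P] [Fintype β]
    (p : P) (F : (P → β) → ℝ) :
    ∑ θ : P → β, ∑ b, F (Function.update θ p b) = Fintype.card β * ∑ θ, F θ := by
  -- Exchanging the fresh symbol with the one it replaces permutes the pairs `(θ, b)`.
  have hinv : Function.Involutive fun q : (P → β) × β =>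
      (Function.update q.1 p q.2, q.1 p) := fun q => by simp
  have h := Equiv.sum_comp hinv.toPerm fun q : (P → β) × β => F q.1
  rw [Fintype.sum_prod_type, Fintype.sum_prod_type] at h
  simpa [Finset.mul_sum] using h

/-! ### Rewards that count matched symbols. -/

section Code

variable {X A ι β : Type*} [Fintype ι] [DecidableEq β]

/-- The mean reward `Δ * #{j | the j-th symbol of the arm a is θ (x, j)}`. -/
def matchReward (code : A → ι → Option β) (Δ : ℝ) (θ : X × ι → β) (x : X) (a : A) : ℝ :=
  Δ * ∑ j, if code a j = some (θ (x, j)) then 1 else 0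

/-- The mean reward `matchReward` without the contribution of the coordinate `p`. -/
def matchRewardErase [DecidableEq X] [DecidableEq ι] (code : A → ι → Option β) (Δ : ℝ)
    (θ : X × ι → β) (p : X × ι) (x : X) (a : A) : ℝ :=
  Δ * ∑ j, if (x, j) ≠ p ∧ code a j = some (θ (x, j)) then 1 else 0

lemma matchReward_update_sub_matchRewardErase [DecidableEq X] [DecidableEq ι]
    (code : A → ι → Option β) (Δ : ℝ) (θ : X × ι → β) (p : X × ι) (b : β) (x : X) (a : A) :
    matchReward code Δ (Function.update θ p b) x a - matchRewardErase code Δ θ p x a =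
      if x = p.1 ∧ code a p.2 = some b then Δ else 0 := by
  obtain ⟨i, k⟩ := p
  unfold matchReward matchRewardErase
  rw [← mul_sub, ← Finset.sum_sub_distrib]
  by_cases hx : x = i
  · subst hx
    rw [Finset.sum_eq_single k]
    · by_cases h : code a k = some b <;> simp [h]
    · intro j _ hj
      simp [hj]
    · simp
  · simp [hx]

variable {code : A → ι → Option β} {Δ : ℝ}

lemma matchReward_nonneg (hΔ : 0 ≤ Δ) (θ : X × ι → β) (x : X) (a : A) :
    0 ≤ matchReward code Δ θ x a :=
  mul_nonneg hΔ (Finset.sum_nonneg fun j _ => by split_ifs <;> norm_num)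

lemma matchReward_le (hΔ : 0 ≤ Δ) (θ : X × ι → β) (x : X) (a : A) :
    matchReward code Δ θ x a ≤ Δ * Fintype.card ι := by
  refine mul_le_mul_of_nonneg_left ?_ hΔ
  calc _ ≤ ∑ _j : ι, (1 : ℝ) := Finset.sum_le_sum fun j _ => by split_ifs <;> norm_num
    _ = _ := by simp

lemma matchReward_eq_of_forall (θ : X × ι → β) (x : X) {a : A}
    (ha : ∀ j, code a j = some (θ (x, j))) :
    matchReward code Δ θ x a = Δ * Fintype.card ι := by
  simp [matchReward, ha]

lemma forall_of_le_matchReward (hΔ : 0 < Δ) (θ : X × ι → β) (x : X) {a : A}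
    (ha : Δ * Fintype.card ι ≤ matchReward code Δ θ x a) (j : ι) :
    code a j = some (θ (x, j)) := by
  by_contra hj
  have h : (Fintype.card ι : ℝ) ≤ ∑ j, if code a j = some (θ (x, j)) then (1 : ℝ) else 0 :=
    le_of_mul_le_mul_left ha hΔ
  have h' : (∑ j, if code a j = some (θ (x, j)) then (1 : ℝ) else 0) < ∑ _j : ι, (1 : ℝ) :=
    Finset.sum_lt_sum (fun j _ => by split_ifs <;> norm_num) ⟨j, Finset.mem_univ _, by simp [hj]⟩
  rw [Finset.sum_const, Finset.card_univ, nsmul_one] at h'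
  linarith

/-- Only the arm spelling the hidden word of `x` matches every symbol and so attains the ceiling `Δ
* card ι`. -/
lemma existsUnique_optimal (hΔ : 0 < Δ) (hcode : ∀ w : ι → β, ∃! a, ∀ j, code a j = some (w j))
    (θ : X × ι → β) (x : X) :
    ∃! a, ∀ b, matchReward code Δ θ x b ≤ matchReward code Δ θ x a := by
  obtain ⟨a, ha, hu⟩ := hcode fun j => θ (x, j)
  have hmax := matchReward_eq_of_forall (Δ := Δ) θ x ha
  refine ⟨a, fun b => hmax ▸ matchReward_le hΔ.le θ x b, fun a' ha' => hu a' ?_⟩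
  exact forall_of_le_matchReward hΔ θ x (hmax ▸ ha' a)

lemma iSup_matchReward [Finite A] (hΔ : 0 ≤ Δ)
    (hcode : ∀ w : ι → β, ∃! a, ∀ j, code a j = some (w j)) (θ : X × ι → β) (x : X) :
    ⨆ a, matchReward code Δ θ x a = Δ * Fintype.card ι := by
  obtain ⟨a, ha, -⟩ := hcode fun j => θ (x, j)
  have : Nonempty A := ⟨a⟩
  refine le_antisymm (ciSup_le fun b => matchReward_le hΔ θ x b) ?_
  rw [← matchReward_eq_of_forall (Δ := Δ) θ x ha]
  exact le_ciSup (Set.finite_range fun a => matchReward code Δ θ x a).bddAbove a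

end Code

/-! ### Averaging the regret over the hidden words. -/

section LowerBound

variable {X A ι β : Type*} [Fintype X] [DecidableEq X] [MeasurableSpace X]
  [MeasurableSingletonClass X] [Fintype A] [MeasurableSpace A] [MeasurableSingletonClass A]
  [Fintype ι] [DecidableEq ι] [Fintype β] [DecidableEq β]
  (ρ : Measure X) [IsProbabilityMeasure ρ] (alg : Algorithm X A) {code : A → ι → Option β} {Δ : ℝ}

/-- The probability that in round `t` the arm has `b` as its symbol of index `j` if the context
is `x`. -/
noncomputable def symbolProb (code : A → ι → Option β) (f : X → A → ℝ) (t : ℕ) (x : X) (j : ι)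
    (b : β) : ℝ :=
  ∑ a with code a j = some b, armProb ρ f alg t x a

/-- Distinct symbols at one position belong to disjoint sets of arms; equality may fail because of
arms with symbol `none`. -/
lemma sum_symbolProb_le_one (f : X → A → ℝ) (t : ℕ) (x : X) (j : ι) :
    ∑ b, symbolProb ρ alg code f t x j b ≤ 1 := by
  unfold symbolProb
  classical
  rw [← sum_armProb ρ f alg t x, ← Finset.sum_biUnion]
  · exact Finset.sum_le_sum_of_subset_of_nonneg (Finset.subset_univ _)
      fun a _ _ => armProb_nonneg ρ f alg t x a
  · intro b _ b' _ hbb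
    refine Finset.disjoint_left.2 fun a ha ha' => hbb ?_
    simp only [Finset.mem_filter, Finset.mem_univ, true_and] at ha ha'
    exact Option.some_injective _ (ha.symm.trans ha')

/-- Expected regret in terms of the probabilities of matching the symbols of `θ`. -/
lemma expectedRegret_matchReward (hΔ : 0 ≤ Δ)
    (hcode : ∀ w : ι → β, ∃! a, ∀ j, code a j = some (w j)) (θ : X × ι → β) (T : ℕ) :
    expectedRegret ρ (matchReward code Δ θ) alg T =
      Δ * ∑ t ∈ Finset.range T, ∑ x, ρ.real {x} *
        ∑ j, (1 - symbolProb ρ alg code (matchReward code Δ θ) t x j (θ (x, j))) := by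
  rw [expectedRegret_eq, Finset.mul_sum]
  refine Finset.sum_congr rfl fun t _ => ?_
  rw [Finset.mul_sum]
  refine Finset.sum_congr rfl fun x _ => ?_
  rw [mul_left_comm]
  congr 1
  simp_rw [iSup_matchReward hΔ hcode]
  have h1 : ∑ a, armProb ρ (matchReward code Δ θ) alg t x a * matchReward code Δ θ x a =
      Δ * ∑ j, symbolProb ρ alg code (matchReward code Δ θ) t x j (θ (x, j)) := by
    simp only [symbolProb, Finset.sum_filter]
    rw [Finset.sum_comm, Finset.mul_sum]
    refine Finset.sum_congr rfl fun a _ => ?_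
    conv_lhs => rw [matchReward]
    rw [mul_left_comm, Finset.mul_sum]
    congr 1
    exact Finset.sum_congr rfl fun j _ => by split_ifs <;> simp
  simp only [mul_sub, Finset.sum_sub_distrib]
  rw [h1, ← Finset.sum_mul, sum_armProb]
  simp

/-- If one symbol of `θ` is resampled uniformly, then it is rarely matched. -/
lemma sum_symbolProb_update_le {T : ℕ} {w : ℝ} (hw : ∀ x, ρ.real {x} = w)
    (hΔ : 32 * w * T * Δ ^ 2 ≤ Fintype.card β) {t : ℕ} (ht : t ≤ T) (θ : X × ι → β) (x : X)
    (j : ι) :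
    ∑ b, symbolProb ρ alg code (matchReward code Δ (Function.update θ (x, j) b)) t x j b ≤
      1 + Fintype.card β / 4 := by
  set g := matchRewardErase code Δ θ (x, j) with hg
  have hw0 : 0 ≤ w := hw x ▸ measureReal_nonneg
  -- Restoring the coordinate changes the mean only in context `x`, which has probability `w`, and
  -- only for arms with symbol `b` at position `j`.
  have hkl : ∀ b, ∑ s ∈ Finset.range t, ∑ x', ρ.real {x'} * ∑ a, armProb ρ g alg s x' a *
      ((matchReward code Δ (Function.update θ (x, j) b) x' a - g x' a) ^ 2 / 2) =
      w * (Δ ^ 2 / 2) * ∑ s ∈ Finset.range t, symbolProb ρ alg code g s x j b := by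
    intro b
    rw [Finset.mul_sum]
    refine Finset.sum_congr rfl fun s _ => ?_
    simp only [hg, matchReward_update_sub_matchRewardErase]
    rw [Finset.sum_eq_single x]
    · rw [hw, mul_assoc]
      congr 1
      rw [symbolProb, Finset.sum_filter, Finset.mul_sum]
      refine Finset.sum_congr rfl fun a _ => ?_
      by_cases h : code a j = some b <;> simp [h, mul_comm]
    · intro x' _ hx'
      simp [hx']
    · simp
  -- The Pinsker parameter `16` makes the additive errors sum to `card β / 8`; by `hΔ` the
  -- divergences contribute at most another `card β / 8`.
  have h1 : ∀ b, symbolProb ρ alg code (matchReward code Δ (Function.update θ (x, j) b)) t x j b ≤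
      symbolProb ρ alg code g t x j b +
        16 / 2 * (w * (Δ ^ 2 / 2) * ∑ s ∈ Finset.range t, symbolProb ρ alg code g s x j b) +
        2 / 16 := fun b => by
    rw [← hkl]
    exact sum_armProb_le ρ _ g alg t x _ (by norm_num)
  -- All terms refer to the one law under `g`, so the symbols share a budget of `T` rounds.
  have h2 : ∑ b, ∑ s ∈ Finset.range t, symbolProb ρ alg code g s x j b ≤ T := by
    rw [Finset.sum_comm]
    calc _ ≤ ∑ _s ∈ Finset.range t, (1 : ℝ) :=
          Finset.sum_le_sum fun s _ => sum_symbolProb_le_one ρ alg g s x j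
      _ ≤ T := by simpa using ht
  calc _ ≤ ∑ b, (symbolProb ρ alg code g t x j b +
        16 / 2 * (w * (Δ ^ 2 / 2) * ∑ s ∈ Finset.range t, symbolProb ρ alg code g s x j b) +
        2 / 16) := Finset.sum_le_sum fun b _ => h1 b
    _ = ∑ b, symbolProb ρ alg code g t x j b + 4 * (w * Δ ^ 2) *
        (∑ b, ∑ s ∈ Finset.range t, symbolProb ρ alg code g s x j b) + Fintype.card β / 8 := by
        rw [Finset.sum_add_distrib, Finset.sum_add_distrib, Finset.mul_sum]
        simp only [Finset.sum_const, Finset.card_univ, nsmul_eq_mul]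
        congr 1
        · congr 1
          exact Finset.sum_congr rfl fun b _ => by ring
        · ring
    _ ≤ 1 + 4 * (w * Δ ^ 2) * T + Fintype.card β / 8 := by
        gcongr
        exact sum_symbolProb_le_one ρ alg g t x j
    _ ≤ _ := by linarith

/-- Every algorithm has large regret on one of the reward functions `matchReward code Δ θ`. -/
theorem exists_le_expectedRegret_matchReward {T : ℕ} {w : ℝ} (hw : ∀ x, ρ.real {x} = w)
    (hΔ0 : 0 ≤ Δ) (hΔ : 32 * w * T * Δ ^ 2 ≤ Fintype.card β) (hβ : 2 ≤ Fintype.card β)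
    (hcode : ∀ w : ι → β, ∃! a, ∀ j, code a j = some (w j)) :
    ∃ θ : X × ι → β,
      T * Fintype.card ι * Δ / 4 ≤ expectedRegret ρ (matchReward code Δ θ) alg T := by
  have hβ' : (2 : ℝ) ≤ Fintype.card β := by exact_mod_cast hβ
  have : Nonempty β := Fintype.card_pos_iff.1 (by omega)
  have hw0 : ∀ x, 0 ≤ ρ.real {x} := fun x => measureReal_nonneg
  have hmatch : ∀ t ∈ Finset.range T, ∀ x j,
      ∑ θ : X × ι → β, symbolProb ρ alg code (matchReward code Δ θ) t x j (θ (x, j)) ≤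
        ∑ _θ : X × ι → β, (3 / 4 : ℝ) := by
    intro t ht x j
    have h := sum_sum_update (x, j) fun θ : X × ι → β =>
      symbolProb ρ alg code (matchReward code Δ θ) t x j (θ (x, j))
    simp only [Function.update_self] at h
    -- Here `1 + card β / 4 ≤ card β * (3 / 4)` because `card β ≥ 2`.
    have h' : ∑ θ : X × ι → β, ∑ b, symbolProb ρ alg code
        (matchReward code Δ (Function.update θ (x, j) b)) t x j b ≤
        ∑ _θ : X × ι → β, (Fintype.card β * (3 / 4) : ℝ) :=
      Finset.sum_le_sum fun θ _ => (sum_symbolProb_update_le ρ alg hw hΔ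
        (Finset.mem_range.1 ht).le θ x j).trans (by linarith)
    rw [h, ← Finset.mul_sum] at h'
    exact le_of_mul_le_mul_left h' (by linarith)
  suffices h : ∑ _θ : X × ι → β, (T * Fintype.card ι * Δ / 4) ≤
      ∑ θ : X × ι → β, expectedRegret ρ (matchReward code Δ θ) alg T by
    obtain ⟨θ, -, hθ⟩ := Finset.exists_le_of_sum_le Finset.univ_nonempty h
    exact ⟨θ, hθ⟩
  simp_rw [expectedRegret_matchReward ρ alg hΔ0 hcode]
  rw [← Finset.mul_sum, Finset.sum_comm]
  have hone : ∑ x, ρ.real {x} = 1 := by simp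
  calc ∑ _θ : X × ι → β, (T * Fintype.card ι * Δ / 4)
      = Δ * ∑ _t ∈ Finset.range T, ∑ x, ρ.real {x} *
          ∑ _j : ι, ∑ _θ : X × ι → β, (1 - 3 / 4 : ℝ) := by
        rw [Finset.sum_congr rfl fun t _ => (Finset.sum_mul _ _ _).symm, hone]
        simp only [Finset.sum_const, Finset.card_univ, Finset.card_range, nsmul_eq_mul]
        ring
    _ ≤ _ := by
        refine mul_le_mul_of_nonneg_left (Finset.sum_le_sum fun t ht => ?_) hΔ0
        refine le_of_le_of_eq (Finset.sum_le_sum fun x _ => ?_) Finset.sum_comm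
        rw [← Finset.mul_sum]
        refine mul_le_mul_of_nonneg_left ?_ (hw0 x)
        refine le_of_le_of_eq (Finset.sum_le_sum fun j _ => ?_) Finset.sum_comm
        rw [Finset.sum_sub_distrib, Finset.sum_sub_distrib]
        linarith [hmatch t ht x j]

end LowerBound

/-! ### Representations and codes. -/

/-- Up to `d` functions are jointly linear in one `d`-dimensional representation. -/
lemma exists_representation {X A κ : Type*} [Fintype κ] {d : ℕ} (hd : Fintype.card κ ≤ d)
    (u : κ → X → A → ℝ) :
    ∃ φ : X → A → Fin d → ℝ, ∀ c : κ → ℝ, ∃ v, ∀ x a, ∑ i, c i * u i x a = φ x a ⬝ᵥ v := by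
  obtain ⟨e⟩ := Function.Embedding.nonempty_of_card_le (α := κ) (β := Fin d) (by simpa using hd)
  refine ⟨fun x a => Function.extend e (fun i => u i x a) 0, fun c =>
    ⟨Function.extend e c 0, fun x a => ?_⟩⟩
  refine Fintype.sum_of_injective e e.injective _ _ (fun k hk => ?_) fun i => ?_
  · rw [Function.extend_apply' _ _ _ hk]
    simp
  · simp only [e.injective.extend_apply, mul_comm]

/-- There is one indicator feature per context, position and symbol. The features involve neither
`Δ` nor `θ`, so `φ` can be fixed before the horizon and the algorithm. -/
lemma exists_representation_matchReward {X A ι β : Type*} [Fintype X] [Fintype ι] [Fintype β]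
    [DecidableEq β] (code : A → ι → Option β) {d : ℕ} (hd : Fintype.card ((X × ι) × β) ≤ d) :
    ∃ φ : X → A → Fin d → ℝ, ∀ (Δ : ℝ) (θ : X × ι → β),
      matchReward code Δ θ ∈ functionClass {φ} := by
  classical
  obtain ⟨φ, hφ⟩ := exists_representation hd fun p (x : X) (a : A) =>
    if p.1.1 = x ∧ code a p.1.2 = some p.2 then 1 else 0
  refine ⟨φ, fun Δ θ => ⟨φ, rfl, ?_⟩⟩
  obtain ⟨v, hv⟩ := hφ fun p => if θ p.1 = p.2 then Δ else 0
  refine ⟨v, fun x a => ?_⟩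
  rw [← hv, matchReward, Fintype.sum_prod_type, Fintype.sum_prod_type, Finset.sum_eq_single x]
  · rw [Finset.mul_sum]
    refine Finset.sum_congr rfl fun j _ => ?_
    rw [Finset.sum_eq_single (θ (x, j))]
    · simp
    · intro b _ hb
      simp [hb.symm]
    · simp
  · intro y _ hy
    simp [hy]
  · simp

/-- Up to `d * N` functions are linear in one of `N` representations of dimension `d`. -/
lemma exists_finset_representations {X A Θ : Type*} [Fintype Θ] {d N : ℕ}
    (hd : Fintype.card Θ ≤ d * N) (F : Θ → X → A → ℝ) :
    ∃ S : Finset (X → A → Fin d → ℝ), S.card ≤ N ∧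
      ∀ (Δ : ℝ) (θ : Θ), (fun x a => Δ * F θ x a) ∈ functionClass (S : Set (X → A → Fin d → ℝ)) := by
  classical
  obtain ⟨e⟩ := Function.Embedding.nonempty_of_card_le (α := Θ) (β := Fin N × Fin d)
    (by simpa [mul_comm] using hd)
  -- Each `F θ` occupies its own slot, a coordinate of one of the `N` representations, and a scaled
  -- basis vector recovers it for every `Δ`.
  let φ : Fin N → X → A → Fin d → ℝ := fun p x a k =>
    Function.extend e (fun θ => F θ x a) 0 (p, k)
  refine ⟨Finset.univ.image φ, Finset.card_image_le.trans (by simp), fun Δ θ =>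
    ⟨φ (e θ).1, by simp, Pi.single (e θ).2 Δ, fun x a => ?_⟩⟩
  rw [dotProduct_single]
  simp only [φ, e.injective.extend_apply]
  ring

lemma functionClass_mono {X A : Type*} {d : ℕ} {Φ Φ' : Set (X → A → Fin d → ℝ)} (h : Φ ⊆ Φ') :
    functionClass Φ ⊆ functionClass Φ' := fun _ ⟨φ, hφ, hf⟩ => ⟨φ, h hφ, hf⟩

/-- An alphabet with `B ^ m` words of length `m ≥ 1` can be coded by any larger set of arms. -/
lemma exists_code {A ι β : Type*} [Fintype A] [Fintype ι] [DecidableEq ι] [Nonempty ι] [Fintype β]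
    (h : Fintype.card β ^ Fintype.card ι ≤ Fintype.card A) :
    ∃ code : A → ι → Option β, ∀ w : ι → β, ∃! a, ∀ j, code a j = some (w j) := by
  classical
  obtain ⟨e⟩ := Function.Embedding.nonempty_of_card_le (α := ι → β) (β := A) (by simpa using h)
  -- Surplus arms get `none` everywhere; since `ι` is nonempty they cannot spell a word vacuously.
  refine ⟨fun a j => if h : ∃ w, e w = a then some (h.choose j) else none, fun w =>
    ⟨e w, fun j => ?_, fun a ha => ?_⟩⟩
  · have hw : ∃ w', e w' = e w := ⟨w, rfl⟩
    simp only [dif_pos hw]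
    rw [e.injective hw.choose_spec]
  · by_cases hw : ∃ w, e w = a
    · simp only [dif_pos hw, Option.some.injEq] at ha
      rw [← hw.choose_spec, funext ha]
    · simp [hw] at ha

/-! ### Choice of parameters and the two regimes. -/

/-- The lower bound for a class that contains all functions `matchReward code Δ θ`. -/
lemma exists_lower_bound {N A d n m B : ℕ} (hn : 0 < n) (hA : 0 < A) (hd : 0 < d) (hB : 2 ≤ B)
    {code : Fin A → Fin m → Option (Fin B)}
    (hcode : ∀ w : Fin m → Fin B, ∃! a, ∀ j, code a j = some (w j))
    {S : Finset (Fin n → Fin A → Fin d → ℝ)} (hS : S.card ≤ N)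
    (hmem : ∀ Δ θ, matchReward code Δ θ ∈ functionClass (S : Set (Fin n → Fin A → Fin d → ℝ)))
    {K : ℝ} (hK1 : K ≤ 8 * (n * B * m ^ 2)) (hK2 : (n * B * m ^ 2 : ℝ) ≤ 32 * K) :
    ∃ (n : ℕ) (ρ : PMF (Fin n)) (Φ : Finset (Fin n → Fin A → Fin d → ℝ)),
      ρ.support = Set.univ ∧ Φ.card = N ∧
      ∀ (alg : Algorithm (Fin n) (Fin A)) (T : ℕ), 0 < T →
        ∃ f ∈ functionClass (Φ : Set (Fin n → Fin A → Fin d → ℝ)),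
          (∀ x, ∃! a, ∀ b, f x b ≤ f x a) ∧ (∀ x a, 0 ≤ f x a ∧ f x a ≤ √(K / T)) ∧
          1 / 64 * √(T * K) ≤ expectedRegret ρ.toMeasure f alg T := by
  have : Nonempty (Fin n) := ⟨⟨0, hn⟩⟩
  have : Nonempty (Fin A) := ⟨⟨0, hA⟩⟩
  have : Nonempty (Fin d) := ⟨⟨0, hd⟩⟩
  -- Padding to exactly `N` representations only enlarges the function class.
  obtain ⟨Φ, hSΦ, hΦ⟩ := Infinite.exists_superset_card_eq S N hS
  refine ⟨n, PMF.uniformOfFintype (Fin n), Φ, PMF.support_uniformOfFintype _, hΦ,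
    fun alg T hT => ?_⟩
  have hn' : (0 : ℝ) < n := by exact_mod_cast hn
  have hT' : (0 : ℝ) < T := by exact_mod_cast hT
  have hB' : (0 : ℝ) < B := by exact_mod_cast (by omega : 0 < B)
  have hw : ∀ x, (PMF.uniformOfFintype (Fin n)).toMeasure.real {x} = (n : ℝ)⁻¹ := fun x => by
    rw [measureReal_def, PMF.toMeasure_apply_singleton _ _ (measurableSet_singleton x)]
    simp
  -- The largest gap allowed by the averaging bound: `32 * n⁻¹ * T * Δ ^ 2 = B`.
  set Δ : ℝ := √(n * B / (32 * T))
  have hΔ : 0 < Δ := Real.sqrt_pos.2 (by positivity)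
  have hΔsq : Δ ^ 2 = n * B / (32 * T) := Real.sq_sqrt (by positivity)
  obtain ⟨θ, hθ⟩ := exists_le_expectedRegret_matchReward (X := Fin n) (T := T) (Δ := Δ)
    (PMF.uniformOfFintype (Fin n)).toMeasure alg hw hΔ.le
    (by rw [hΔsq, Fintype.card_fin]; exact le_of_eq (by field_simp)) (by simpa using hB) hcode
  have hm0 : (0 : ℝ) ≤ m := Nat.cast_nonneg m
  refine ⟨matchReward code Δ θ, functionClass_mono (by exact_mod_cast hSΦ) (hmem Δ θ),
    fun x => existsUnique_optimal hΔ hcode θ x, fun x a => ⟨matchReward_nonneg hΔ.le θ x a,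
      (matchReward_le hΔ.le θ x a).trans ?_⟩, le_trans ?_ hθ⟩
  · refine Real.le_sqrt_of_sq_le ?_
    rw [mul_pow, hΔsq, Fintype.card_fin, le_div_iff₀ hT']
    calc (n * B / (32 * T) * m ^ 2 * T : ℝ) = (n * B * m ^ 2) / 32 := by field_simp
      _ ≤ K := by linarith
  · rw [Fintype.card_fin]
    -- Together with the factor `1 / 4` in `hθ` this gives the constant `1 / 64`.
    have : √(T * K) ≤ 16 * (T * m * Δ) := by
      refine Real.sqrt_le_iff.2 ⟨by positivity, ?_⟩
      calc T * K ≤ T * (8 * (n * B * m ^ 2)) := by gcongr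
        _ = (16 * (T * m * Δ)) ^ 2 := by
          rw [mul_pow, mul_pow, hΔsq]; field_simp; ring
    linarith

/-- The lower bound of `theorem2` at a hard instance. -/
theorem exists_lower_bound_of_dim {N A d : ℕ} (hN : 1 ≤ N) (hA : 4 ≤ A)
    (hd : 12 * Real.logb 2 A ≤ (d : ℝ)) :
    ∃ (n : ℕ) (ρ : PMF (Fin n)) (Φ : Finset (Fin n → Fin A → Fin d → ℝ)),
      ρ.support = Set.univ ∧ Φ.card = N ∧
      ∀ (alg : Algorithm (Fin n) (Fin A)) (T : ℕ), 0 < T →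
        ∃ f ∈ functionClass (Φ : Set (Fin n → Fin A → Fin d → ℝ)),
          (∀ x, ∃! a, ∀ b, f x b ≤ f x a) ∧
          (∀ x a, 0 ≤ f x a ∧ f x a ≤ √((d * Real.logb 2 A
            + A * (⌊Real.log ((d : ℝ) * N) / Real.log A⌋₊ : ℝ)) / T)) ∧
          1 / 64 * √(T * (d * Real.logb 2 A
            + A * (⌊Real.log ((d : ℝ) * N) / Real.log A⌋₊ : ℝ))) ≤
            expectedRegret ρ.toMeasure f alg T := by
  set ℓ := Real.logb 2 A with hℓ
  set L := ⌊Real.log ((d : ℝ) * N) / Real.log A⌋₊ with hL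
  have hA' : (4 : ℝ) ≤ A := by exact_mod_cast hA
  set m := Nat.log 2 A with hm
  have hm2 : 2 ≤ m := Nat.le_log_of_pow_le (by norm_num) (by simpa using hA)
  have hm2' : (2 : ℝ) ≤ m := by exact_mod_cast hm2
  have hmℓ : (m : ℝ) ≤ ℓ := by
    rw [hℓ, Real.le_logb_iff_rpow_le (by norm_num) (by linarith), Real.rpow_natCast]
    exact_mod_cast Nat.pow_log_le_self 2 (by omega)
  have hℓm : ℓ ≤ m + 1 := by
    rw [hℓ, Real.logb_le_iff_le_rpow (by norm_num) (by linarith)]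
    exact_mod_cast (Nat.lt_pow_succ_log_self (by norm_num) A).le
  have hd0' : (0 : ℝ) < d := by linarith
  have hd0 : 0 < d := by exact_mod_cast hd0'
  rcases le_total (A * L : ℝ) (d * ℓ) with hcase | hcase
  -- Regime `K ≤ 2 * d * ℓ`: binary words. The `n * m * 2` indicator features fit into dimension
  -- `d`, and rounding costs only constants since `d ≤ 4 * m * n` and `ℓ ≤ 2 * m`.
  · have h2m : 2 * m ≤ d := by
      have : (2 * m : ℝ) ≤ d := by linarith
      exact_mod_cast this
    have hn : 0 < d / (2 * m) := Nat.div_pos h2m (by omega)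
    have hle : d / (2 * m) * (2 * m) ≤ d := Nat.div_mul_le_self _ _
    have hlt : d < 2 * m * (d / (2 * m) + 1) := Nat.lt_mul_div_succ d (by omega)
    set n := d / (2 * m)
    have hle' : (n * (2 * m) : ℝ) ≤ d := by exact_mod_cast hle
    have hlt' : (d : ℝ) < 2 * m * (n + 1) := by exact_mod_cast hlt
    have hn' : (1 : ℝ) ≤ n := by exact_mod_cast hn
    have : NeZero m := ⟨by omega⟩
    obtain ⟨code, hcode⟩ := exists_code (A := Fin A) (ι := Fin m) (β := Fin 2)
      (by simpa using Nat.pow_log_le_self 2 (by omega))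
    obtain ⟨φ, hφ⟩ := exists_representation_matchReward (X := Fin n) code (d := d)
      (by simpa [mul_assoc, mul_comm, mul_left_comm] using hle)
    refine exists_lower_bound (S := {φ}) hn (by omega) hd0 le_rfl hcode (by simpa using hN)
      (by simpa using hφ) ?_ ?_
    · have h1 : (d : ℝ) ≤ 4 * m * n := by nlinarith
      have h2 : d * ℓ ≤ 4 * m * n * (2 * m) :=
        mul_le_mul h1 (by linarith) (by linarith) (by positivity)
      push_cast
      nlinarith
    · have h1 : (n * (2 * m) : ℝ) * m ≤ d * ℓ := mul_le_mul hle' hmℓ (by linarith) hd0'.le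
      have h2 : (0 : ℝ) ≤ A * L := by positivity
      push_cast
      nlinarith
  -- Regime `K ≤ 2 * A * L`: `L` contexts, and each arm is its own one-letter word.
  · have hL0 : 0 < L := by
      by_contra h
      have : L = 0 := by omega
      rw [this] at hcase
      have : 0 < d * ℓ := mul_pos hd0' (by linarith)
      simp at hcase
      linarith
    -- The floor in `K` is the largest number of contexts for which all `A ^ L` hidden assignments
    -- fit into the `d * N` slots.
    have hpow : A ^ L ≤ d * N := by
      have hlogA : 0 < Real.log A := Real.log_pos (by linarith)
      have hdN : (0 : ℝ) < d * N := mul_pos hd0' (by exact_mod_cast hN)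
      have h1 : (L : ℝ) ≤ Real.log ((d : ℝ) * N) / Real.log A :=
        Nat.floor_le (Nat.floor_pos.1 hL0 |> zero_le_one.trans)
      rw [le_div_iff₀ hlogA, ← Real.log_pow, Real.log_le_log_iff (by positivity) hdN] at h1
      exact_mod_cast h1
    obtain ⟨code, hcode⟩ := exists_code (A := Fin A) (ι := Fin 1) (β := Fin A) (by simp)
    obtain ⟨S, hS, hmem⟩ := exists_finset_representations (Θ := Fin L × Fin 1 → Fin A) (d := d)
      (N := N) (by simpa using hpow) (matchReward code 1)
    refine exists_lower_bound (m := 1) hL0 (by omega) hd0 (by omega) hcode hS (fun Δ θ => ?_) ?_ ?_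
    · have h := hmem Δ θ
      simp only [matchReward, one_mul] at h
      exact h
    · push_cast
      nlinarith
    · have : 0 ≤ d * ℓ := mul_nonneg hd0'.le (by linarith)
      push_cast
      nlinarith

end ContextualBandit

theorem theorem2 :
    ∃ c : ℝ, 0 < c ∧
      ∀ N A d : ℕ, 1 ≤ N → 4 ≤ A → 12 * Real.logb 2 A ≤ (d : ℝ) →
        ∃ (n : ℕ) (ρ : PMF (Fin n)) (Φ : Finset (Fin n → Fin A → Fin d → ℝ)),
          ρ.support = Set.univ ∧ Φ.card = N ∧
          ∀ (alg : ContextualBandit.Algorithm (Fin n) (Fin A)) (T : ℕ),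
            max (⌊Real.log ((d : ℝ) * N) / Real.log A⌋₊ : ℝ) (d / Real.logb 2 A) ≤ (T : ℝ) →
            -- the worst-case regret over the whole class
            ((c * √(T * (d * Real.logb 2 A
                  + A * (⌊Real.log ((d : ℝ) * N) / Real.log A⌋₊ : ℝ))) : ℝ) : EReal)
              ≤ (⨆ f ∈ ContextualBandit.functionClass
                    (Φ : Set (Fin n → Fin A → Fin d → ℝ)),
                  ((ContextualBandit.expectedRegret ρ.toMeasure f alg T : ℝ) : EReal)) ∧
            -- the bound holds at an instance with small rewards and unique optimal arms
            ∃ f ∈ ContextualBandit.functionClass (Φ : Set (Fin n → Fin A → Fin d → ℝ)),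
              (∀ x, ∃! a, ∀ b, f x b ≤ f x a) ∧
              (∀ x a, 0 ≤ f x a ∧
                f x a ≤ √((d * Real.logb 2 A
                  + A * (⌊Real.log ((d : ℝ) * N) / Real.log A⌋₊ : ℝ)) / T)) ∧
              c * √(T * (d * Real.logb 2 A
                  + A * (⌊Real.log ((d : ℝ) * N) / Real.log A⌋₊ : ℝ)))
                ≤ ContextualBandit.expectedRegret ρ.toMeasure f alg T := by
  refine ⟨1 / 64, by norm_num, fun N A d hN hA hd => ?_⟩
  obtain ⟨n, ρ, Φ, hρ, hΦ, h⟩ := ContextualBandit.exists_lower_bound_of_dim hN hA hd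
  refine ⟨n, ρ, Φ, hρ, hΦ, fun alg T hT => ?_⟩
  have hlog : 0 < Real.logb 2 A :=
    Real.logb_pos (by norm_num) (by exact_mod_cast (by omega : 1 < A))
  have hT0 : (0 : ℝ) < T :=
    (div_pos (by linarith) hlog).trans_le ((le_max_right _ _).trans hT)
  obtain ⟨f, hf, hu, hb, hr⟩ := h alg T (by exact_mod_cast hT0)
  -- In `EReal` the supremum needs no boundedness, so the single hard `f` bounds it from below.
  exact ⟨le_iSup₂_of_le f hf (EReal.coe_le_coe_iff.2 hr), f, hf, hu, hb, hr⟩
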